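/- Let $a,b,c,d\in\mathbb{R}$ with $ac\neq 0$, put $A(z)=az+b$, $B(z)=cz+d$, and let $\{W_n(z)\}_{n\ge 0}$ be the sequence of polynomials defined by $W_0(z)=1$, $W_1(z)=z$ and $$W_n(z)=A(z)W_{n-1}(z)+B(z)W_{n-2}(z)\qquad(n\ge 2).$$ Assume that $\{W_n(z)\}_n$ satisfies no recurrence of order less than two, that is, there is no polynomial $p(z)$ with $W_{n+1}(z)=p(z)W_n(z)$ for all $n\ge 0$ (equivalently, $(a,\,b+c,\,d)\neq(1,0,0)$, i.e. it is not the case that $W_n(z)=z^n$ for all $n$). Let $x_A=-b/a$ be the zero of $A$, and let $\Delta_\Delta=c^2-a^2B(x_A)$, which is, up to the factor $16$, the discriminant of the quadratic polynomial $\Delta(z)=A(z)^2+4B(z)$. If for all sufficiently large $n$ the polynomial $W_n(z)$ is real-rooted (all its complex zeros are real), then $B(x_A)\le 0$, and consequently $\Delta_\Delta\ge 0$. -/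

import Mathlib

open Polynomial Filter

namespace LinRec

/-- The linear polynomial `A(z) = a z + b`. -/
noncomputable def A (a b : ℝ) : ℝ[X] := C a * X + C b

/-- The linear polynomial `B(z) = c z + d`. -/
noncomputable def B (c d : ℝ) : ℝ[X] := C c * X + C d

/-- The normalized sequence `W₀ = 1`, `W₁ = z`, `Wₙ = A Wₙ₋₁ + B Wₙ₋₂` for `n ≥ 2`. -/
noncomputable def W (a b c d : ℝ) : ℕ → ℝ[X]
  | 0 => 1
  | 1 => X
  | n + 2 => A a b * W a b c d (n + 1) + B c d * W a b c d n

/-- The zero `x_A = -b/a` of `A` (used for `a ≠ 0`). -/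
noncomputable def xA (a b : ℝ) : ℝ := -b / a

/-- The number `Δ_Δ = c² - a² B(x_A)`; one sixteenth of the usual discriminant of the quadratic
polynomial `Δ(z) = A(z)² + 4 B(z)`. -/
noncomputable def DeltaDelta (a b c d : ℝ) : ℝ := c ^ 2 - a ^ 2 * (B c d).eval (xA a b)

/-- A real polynomial is real-rooted if all its complex zeros are real. -/
def RealRooted (p : ℝ[X]) : Prop := ∀ z : ℂ, aeval z p = 0 → z.im = 0

/-- A sequence of polynomials satisfies a recurrence of order less than two:
`Wₙ₊₁ = p Wₙ` for all `n`, with a fixed polynomial `p` (`p = 0` and order zero included). -/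
def FirstOrderRec (w : ℕ → ℝ[X]) : Prop := ∃ p : ℝ[X], ∀ n : ℕ, w (n + 1) = p * w n

end LinRec

namespace LinRec

open Topology

/-! Suppose `B(x_A) > 0`. By Binet's formula, where the characteristic roots `l`, `m` are distinct,
`W n` vanishes exactly when `(z - m) l ^ n = (z - l) m ^ n`. Such zeros accumulate at points where
`|l| = |m|` (Beraha–Kahane–Weiss), in particular where `A² = -t B` with `0 < t < 4`. This is a
quadratic in `z` of discriminant `t (t c² - 4 a² B(x_A))`, negative for small `t`. Its nonreal
solutions therefore attract nonreal zeros of every `W n` with `n` large. -/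

/-- If `Q` and `h` are analytic at `z₀`, `‖Q z₀‖ = 1`, `Q` is not locally constant and `h z₀ ≠ 0`,
then for large `n` the equation `Q z ^ n = h z` has solutions arbitrarily close to `z₀`. -/
theorem eventually_exists_pow_eq {Q h : ℂ → ℂ} {z₀ : ℂ} {U : Set ℂ} (hQ : AnalyticAt ℂ Q z₀)
    (hh : AnalyticAt ℂ h z₀) (hQ1 : ‖Q z₀‖ = 1) (hne : ¬ ∀ᶠ z in 𝓝 z₀, Q z = Q z₀)
    (hh0 : h z₀ ≠ 0) (hU : U ∈ 𝓝 z₀) : ∀ᶠ n : ℕ in atTop, ∃ z ∈ U, Q z ^ n = h z := by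
  have hQ0 : Q z₀ ≠ 0 := by
    intro h0
    simp [h0] at hQ1
  set L : ℂ → ℂ := fun z => Complex.log (Q z / Q z₀) with hL
  set H : ℂ → ℂ := fun z => Complex.log (h z / h z₀) with hH
  have hLa : AnalyticAt ℂ L z₀ := (hQ.div_const).clog (by simp [div_self hQ0])
  have hHa : AnalyticAt ℂ H z₀ := (hh.div_const).clog (by simp [div_self hh0])
  have hL0 : L z₀ = 0 := by simp [hL]
  have hH0 : H z₀ = 0 := by simp [hH]
  have hpunct : ∀ᶠ z in 𝓝 z₀, z ≠ z₀ → Q z ≠ Q z₀ :=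
    eventually_nhdsWithin_iff.1
      ((hQ.eventually_eq_or_eventually_ne analyticAt_const).resolve_left hne)
  have hall : ∀ᶠ z in 𝓝 z₀, AnalyticAt ℂ L z ∧ AnalyticAt ℂ H z ∧ Q z ≠ 0 ∧ h z ≠ 0 ∧
      (z ≠ z₀ → Q z ≠ Q z₀) ∧ z ∈ U := by
    filter_upwards [hLa.eventually_analyticAt, hHa.eventually_analyticAt,
      hQ.continuousAt.eventually_ne hQ0, hh.continuousAt.eventually_ne hh0, hpunct, hU]
      with z h1 h2 h3 h4 h5 h6 using ⟨h1, h2, h3, h4, h5, h6⟩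
  obtain ⟨r, hr, hball⟩ := Metric.nhds_basis_closedBall.mem_iff.1 hall
  have hLc : ContinuousOn L (Metric.closedBall z₀ r) := fun z hz =>
    (hball hz).1.continuousAt.continuousWithinAt
  have hHc : ContinuousOn H (Metric.closedBall z₀ r) := fun z hz =>
    (hball hz).2.1.continuousAt.continuousWithinAt
  obtain ⟨w, hw, hwmin⟩ := (isCompact_sphere z₀ r).exists_isMinOn
    (NormedSpace.sphere_nonempty.2 hr.le) (hLc.mono Metric.sphere_subset_closedBall).norm
  obtain ⟨M, hM⟩ := (isCompact_sphere z₀ r).exists_bound_of_continuousOn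
    (hHc.mono Metric.sphere_subset_closedBall)
  have hm : 0 < ‖L w‖ := by
    rw [norm_pos_iff]
    intro h0
    have hwb := hball (Metric.sphere_subset_closedBall hw)
    refine hwb.2.2.2.2.1 (Metric.ne_of_mem_sphere hw hr.ne') ?_
    have h1 := Complex.exp_log (div_ne_zero hwb.2.2.1 hQ0)
    have h2 : Complex.log (Q w / Q z₀) = 0 := h0
    rw [h2, Complex.exp_zero] at h1
    exact ((div_eq_one_iff_eq hQ0).1 h1.symm)
  -- The equation becomes `L z - H z / n = log v / n`. As `‖Q z₀‖ = 1`, `K` bounds `log v` uniformly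
  -- in `n`, so the right side tends to `0`.
  set K : ℝ := |Real.log ‖h z₀‖| + Real.pi
  have hlimM : Tendsto (fun n : ℕ => M / (n : ℝ)) atTop (𝓝 0) :=
    tendsto_const_div_atTop_nhds_zero_nat M
  have hlimK : Tendsto (fun n : ℕ => K / (n : ℝ)) atTop (𝓝 0) :=
    tendsto_const_div_atTop_nhds_zero_nat K
  filter_upwards [hlimM.eventually_lt_const (half_pos hm),
    hlimK.eventually_lt_const (half_pos (half_pos hm)), eventually_gt_atTop 0] with n hnM hnK hn
  have hn' : (0 : ℝ) < n := by exact_mod_cast hn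
  have hnC : (n : ℂ) ≠ 0 := by exact_mod_cast hn.ne'
  set v : ℂ := h z₀ / Q z₀ ^ n with hv
  have hv0 : v ≠ 0 := div_ne_zero hh0 (pow_ne_zero _ hQ0)
  have hvn : ‖v‖ = ‖h z₀‖ := by simp [hv, hQ1]
  have hlogv : ‖Complex.log v‖ ≤ K := by
    refine (Complex.norm_le_abs_re_add_abs_im _).trans ?_
    rw [Complex.log_re, Complex.log_im, hvn]
    exact add_le_add le_rfl (Complex.abs_arg_le_pi v)
  have hdiff : DiffContOnCl ℂ (fun z => L z - H z / n) (Metric.ball z₀ r) := by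
    refine DifferentiableOn.diffContOnCl fun z hz => ?_
    have hz' := hball (Metric.closure_ball_subset_closedBall hz)
    exact (hz'.1.differentiableAt.sub
      (hz'.2.1.differentiableAt.div_const _)).differentiableWithinAt
  have hsphere : ∀ z ∈ Metric.sphere z₀ r,
      ‖L w‖ / 2 ≤ ‖L z - H z / n - (L z₀ - H z₀ / n)‖ := fun z hz => by
    have h1 : ‖L w‖ ≤ ‖L z‖ := hwmin hz
    have h2 : ‖H z / (n : ℂ)‖ ≤ M / n := by
      rw [norm_div, Complex.norm_natCast]
      exact div_le_div_of_nonneg_right (hM z hz) hn'.le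
    have h3 := norm_sub_norm_le (L z) (H z / n)
    simp only [hL0, hH0, zero_div, sub_zero]
    linarith
  have hfreq : ∃ᶠ z in 𝓝 z₀, L z - H z / n ≠ L z₀ - H z₀ / n := by
    rw [← not_eventually]
    intro hcon
    have hanal : AnalyticOnNhd ℂ (fun z => L z - H z / n) (Metric.closedBall z₀ r) :=
      fun z hz => (hball hz).1.sub (hball hz).2.1.div_const
    have heq := hanal.eqOn_of_preconnected_of_eventuallyEq
      (g := fun _ => L z₀ - H z₀ / n) (fun _ _ => analyticAt_const)
      (convex_closedBall z₀ r).isPreconnected (Metric.mem_closedBall_self hr.le) hcon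
      (Metric.sphere_subset_closedBall hw)
    have h1 := hsphere w hw
    have h2 : L w - H w / n = L z₀ - H z₀ / n := heq
    rw [h2, sub_self, norm_zero] at h1
    linarith
  -- Quantitative open mapping: the radius of the covered ball does not depend on `n`.
  have himg := hdiff.ball_subset_image_closedBall hr hsphere hfreq
  have hmem : Complex.log v / n ∈ Metric.ball (L z₀ - H z₀ / n) (‖L w‖ / 2 / 2) := by
    rw [hL0, hH0, zero_div, sub_zero, mem_ball_zero_iff, norm_div, Complex.norm_natCast]
    exact (div_le_div_of_nonneg_right hlogv hn'.le).trans_lt hnK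
  obtain ⟨z, hz, hzv⟩ := himg hmem
  obtain ⟨-, -, hQz, hhz, -, hzU⟩ := hball hz
  refine ⟨z, hzU, ?_⟩
  have h1 : (n : ℂ) * L z = Complex.log v + H z := by
    have h2 : L z - H z / n = Complex.log v / n := hzv
    field_simp at h2
    linear_combination h2
  have h2 := congrArg Complex.exp h1
  rw [Complex.exp_nat_mul, Complex.exp_add, Complex.exp_log (div_ne_zero hQz hQ0),
    Complex.exp_log hv0, Complex.exp_log (div_ne_zero hhz hh0), hv] at h2
  rw [div_pow] at h2
  field_simp at h2
  exact h2

/-- Binet's formula for `W`. -/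
theorem sub_mul_aeval_W (a b c d : ℝ) {z l m : ℂ} (hadd : l + m = a * z + b)
    (hmul : l * m = -(c * z + d)) (n : ℕ) :
    (l - m) * aeval z (W a b c d n) = (z - m) * l ^ n - (z - l) * m ^ n := by
  induction n using Nat.twoStepInduction with
  | zero => simp [W]
  | one => simp [W]; ring
  | more n h1 h2 =>
    have hA : aeval z (A a b) = l + m := by simp [A, hadd]
    have hB : aeval z (B c d) = -(l * m) := by simp [B, hmul]
    rw [W, map_add, map_mul, map_mul, hA, hB]
    linear_combination (l + m) * h2 - l * m * h1

/-- Two complex numbers `l, m ≠ 0` with `(l + m)² = t l m`, `0 < t < 4`, have equal modulus. -/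
theorem norm_div_eq_one {l m : ℂ} {t : ℝ} (hm : m ≠ 0) (ht : 0 < t) (ht4 : t < 4)
    (h : (l + m) ^ 2 = t * (l * m)) : ‖l / m‖ = 1 := by
  set q := l / m with hq
  have hl : l = q * m := by rw [hq, div_mul_cancel₀ _ hm]
  have h1 : q ^ 2 + (2 - t) * q + 1 = 0 := by
    have : m ^ 2 * (q ^ 2 + (2 - t) * q + 1) = 0 := by
      rw [hl] at h
      linear_combination h
    exact (mul_eq_zero.1 this).resolve_left (pow_ne_zero _ hm)
  have hre := congrArg Complex.re h1
  have him := congrArg Complex.im h1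
  simp [pow_two] at hre him
  have hns : Complex.normSq q = 1 := by
    rw [Complex.normSq_apply]
    have h3 : q.im * (2 * q.re + (2 - t)) = 0 := by linear_combination him
    -- A real `q` is excluded because the quadratic has discriminant `t² - 4t < 0`.
    rcases mul_eq_zero.1 h3 with h4 | h4
    · exfalso
      rw [h4] at hre
      nlinarith [sq_nonneg (q.re + (2 - t) / 2)]
    · nlinarith
  rw [Complex.norm_def, hns, Real.sqrt_one]

/-- If the sequence is not `zⁿ`, then `z² - A z - B` is a nonzero polynomial. -/
theorem X_sq_sub_ne_zero {a b c d : ℝ} (hN : ¬ FirstOrderRec (W a b c d)) :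
    (X ^ 2 - A a b * X - B c d : ℝ[X]) ≠ 0 := by
  intro h
  refine hN ⟨X, fun n => ?_⟩
  induction n with
  | zero => simp [W]
  | succ n ih =>
    rw [W, ih]
    linear_combination (-W a b c d n) * h

/-- The nonreal solution of `A² = -t B` for small `t > 0`, when `B(x_A) > 0`. -/
theorem exists_nonreal_sq_eq {a b c d t : ℝ} (ha : a ≠ 0) (ht : 0 < t)
    (hdisc : t * c ^ 2 < 4 * a ^ 2 * (B c d).eval (xA a b)) :
    ∃ z : ℂ, z.im ≠ 0 ∧ ((a : ℂ) * z + b) ^ 2 = -t * (c * z + d) := by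
  set β := (B c d).eval (xA a b) with hβ
  have hβ' : β = c * (-b / a) + d := by simp [hβ, B, xA]
  set D := t * (4 * a ^ 2 * β - t * c ^ 2) with hD
  have hDpos : 0 < D := mul_pos ht (sub_pos.2 hdisc)
  set s := √D
  have hs : (s : ℂ) ^ 2 = t * (4 * a ^ 2 * (c * (-b / a) + d) - t * c ^ 2) := by
    rw [← Complex.ofReal_pow, Real.sq_sqrt hDpos.le, hD, hβ']
    push_cast
    ring
  have haC : (a : ℂ) ≠ 0 := by exact_mod_cast ha
  -- Quadratic formula, with discriminant `-D`.
  refine ⟨((-b / a - t * c / (2 * a ^ 2) : ℝ) : ℂ) + ((s / (2 * a ^ 2) : ℝ) : ℂ) * Complex.I,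
    ?_, ?_⟩
  · have hs0 : s ≠ 0 := (Real.sqrt_pos.2 hDpos).ne'
    simp only [Complex.add_im, Complex.ofReal_im, Complex.im_ofReal_mul,
      Complex.I_im]
    simp [hs0, ha]
  · push_cast
    linear_combination (norm := skip) (-1 / (4 * a ^ 2) : ℂ) * hs
      + (s ^ 2 / (4 * a ^ 2) : ℂ) * Complex.I_sq
    field_simp
    ring

/-- When `B(x_A) > 0`, some nonreal solution of `A² = -t B` with `0 < t < 4` is a zero neither of `B`
nor of `z² - A z - B`. -/
theorem exists_good_point {a b c d : ℝ} (ha : a ≠ 0) (hN : ¬ FirstOrderRec (W a b c d))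
    (hβ : 0 < (B c d).eval (xA a b)) :
    ∃ (t : ℝ) (z : ℂ), 0 < t ∧ t < 4 ∧ z.im ≠ 0 ∧ (c * z + d : ℂ) ≠ 0 ∧
      ((a : ℂ) * z + b) ^ 2 = -t * (c * z + d) ∧ z ^ 2 - (a * z + b) * z - (c * z + d) ≠ 0 := by
  set β := (B c d).eval (xA a b)
  set ε := min 4 (4 * a ^ 2 * β / (c ^ 2 + 1)) with hε
  have hεpos : 0 < ε := by positivity
  have hex : ∀ t ∈ Set.Ioo 0 ε, ∃ z : ℂ, z.im ≠ 0 ∧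
      ((a : ℂ) * z + b) ^ 2 = -t * (c * z + d) := fun t ht => by
    refine exists_nonreal_sq_eq ha ht.1 ?_
    have h1 : t < 4 * a ^ 2 * β / (c ^ 2 + 1) := ht.2.trans_le (min_le_right _ _)
    rw [lt_div_iff₀ (by positivity)] at h1
    linarith [ht.1]
  choose! f hf1 hf2 using hex
  have hB : ∀ t ∈ Set.Ioo 0 ε, (c * f t + d : ℂ) ≠ 0 := fun t ht h0 => by
    have h1 := hf2 t ht
    rw [h0, mul_zero] at h1
    have h2 := congrArg Complex.im (pow_eq_zero_iff two_ne_zero |>.1 h1)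
    simp [ha, hf1 t ht] at h2
  -- Distinct `t` give distinct points, so infinitely many candidates face a finite exceptional set.
  have hinj : Set.InjOn f (Set.Ioo 0 ε) := fun t ht u hu htu => by
    have h1 := hf2 t ht
    rw [htu, hf2 u hu] at h1
    have h2 := mul_right_cancel₀ (hB u hu) h1
    exact_mod_cast (neg_injective h2).symm
  have hinf : (f '' Set.Ioo 0 ε).Infinite := (Set.Ioo_infinite hεpos).image hinj
  have hfin := (((X ^ 2 - A a b * X - B c d : ℝ[X])).rootSet_finite ℂ)
  obtain ⟨z, ⟨t, ht, rfl⟩, hz⟩ := (hinf.sdiff hfin).nonempty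
  refine ⟨t, f t, ht.1, ht.2.trans_le (min_le_left _ _), hf1 t ht, hB t ht, hf2 t ht, ?_⟩
  intro h0
  refine hz ((mem_rootSet_of_ne (X_sq_sub_ne_zero hN)).2 ?_)
  simpa [A, B] using h0

/-- If `B(x_A) > 0`, then `W n` has a nonreal zero for all large `n`. -/
theorem eventually_not_realRooted {a b c d : ℝ} (ha : a ≠ 0)
    (hN : ¬ FirstOrderRec (W a b c d)) (hβ : 0 < (B c d).eval (xA a b)) :
    ∀ᶠ n : ℕ in atTop, ¬ RealRooted (W a b c d n) := by
  obtain ⟨t, z₀, ht, ht4, him, hB0, hsq, hg⟩ := exists_good_point ha hN hβ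
  have haC : (a : ℂ) ≠ 0 := by exact_mod_cast ha
  set Δ : ℂ → ℂ := fun z => (a * z + b) ^ 2 + 4 * (c * z + d) with hΔ
  have hΔa : AnalyticAt ℂ Δ z₀ := by
    rw [hΔ]
    fun_prop
  have hΔ0 : Δ z₀ ≠ 0 := by
    have h1 : Δ z₀ = (4 - t : ℝ) * (c * z₀ + d) := by
      push_cast
      linear_combination hsq
    rw [h1]
    exact mul_ne_zero (by exact_mod_cast (sub_pos.2 ht4).ne') hB0
  obtain ⟨s, hs⟩ := IsAlgClosed.exists_pow_nat_eq (Δ z₀) two_pos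
  have hs0 : s ≠ 0 := by
    rintro rfl
    exact hΔ0 (by simpa using hs.symm)
  -- An analytic branch of `√Δ` near `z₀`.
  set S : ℂ → ℂ := fun z => s * Complex.exp (Complex.log (Δ z / Δ z₀) / 2) with hS
  have hSa : AnalyticAt ℂ S z₀ :=
    analyticAt_const.mul ((hΔa.div_const.clog (by simp [div_self hΔ0])).div_const.cexp)
  have hS0 : ∀ z, S z ≠ 0 := fun z => mul_ne_zero hs0 (Complex.exp_ne_zero _)
  have hSsq : ∀ z, Δ z ≠ 0 → S z ^ 2 = Δ z := fun z hz => by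
    simp only [hS]
    rw [mul_pow, ← Complex.exp_nat_mul, hs, Nat.cast_two, mul_div_cancel₀ _ two_ne_zero,
      Complex.exp_log (div_ne_zero hz hΔ0), mul_div_cancel₀ _ hΔ0]
  set l : ℂ → ℂ := fun z => (a * z + b + S z) / 2 with hl
  set m : ℂ → ℂ := fun z => (a * z + b - S z) / 2 with hm
  have hlin : AnalyticAt ℂ (fun z : ℂ => (a : ℂ) * z + b) z₀ := by fun_prop
  have hla : AnalyticAt ℂ l z₀ := (hlin.add hSa).div_const
  have hma : AnalyticAt ℂ m z₀ := (hlin.sub hSa).div_const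
  have hadd : ∀ z, l z + m z = a * z + b := fun z => by simp only [hl, hm]; ring
  have hmul : ∀ z, Δ z ≠ 0 → l z * m z = -(c * z + d) := fun z hz => by
    have h1 := hSsq z hz
    simp only [hl, hm]
    simp only [hΔ] at h1
    linear_combination (-1 / 4 : ℂ) * h1
  have hlm0 : l z₀ * m z₀ ≠ 0 := by rw [hmul z₀ hΔ0]; exact neg_ne_zero.2 hB0
  have hm0 : m z₀ ≠ 0 := right_ne_zero_of_mul hlm0
  have hl0 : l z₀ ≠ 0 := left_ne_zero_of_mul hlm0
  have hgl : (z₀ - m z₀) * (z₀ - l z₀) ≠ 0 := by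
    convert hg using 1
    linear_combination (-z₀) * hadd z₀ + hmul z₀ hΔ0
  have hzm : z₀ - m z₀ ≠ 0 := left_ne_zero_of_mul hgl
  have hzl : z₀ - l z₀ ≠ 0 := right_ne_zero_of_mul hgl
  have hzma : AnalyticAt ℂ (fun z => z - m z) z₀ := analyticAt_id.sub hma
  have hzla : AnalyticAt ℂ (fun z => z - l z) z₀ := analyticAt_id.sub hla
  have hnorm : ‖l z₀ / m z₀‖ = 1 := norm_div_eq_one hm0 ht ht4 (by
    rw [hadd, hmul z₀ hΔ0, hsq]; ring)
  have hU : ∀ᶠ z in 𝓝 z₀, z.im ≠ 0 ∧ Δ z ≠ 0 ∧ m z ≠ 0 ∧ z - m z ≠ 0 := by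
    filter_upwards [Complex.continuous_im.continuousAt.eventually_ne him,
      hΔa.continuousAt.eventually_ne hΔ0, hma.continuousAt.eventually_ne hm0,
      hzma.continuousAt.eventually_ne hzm] with z h1 h2 h3 h4 using ⟨h1, h2, h3, h4⟩
  have hne : ¬ ∀ᶠ z in 𝓝 z₀, l z / m z = l z₀ / m z₀ := by
    intro hcon
    set q := l z₀ / m z₀ with hq
    have hq0 : q ≠ 0 := div_ne_zero hl0 hm0
    -- If `l = q m`, then `q (l + m)² = (1 + q)² l m`, so `p = q A² + (1 + q)² B` vanishes near
    -- `z₀`.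
    set p : ℂ[X] := C (q * a ^ 2) * X ^ 2 + C (2 * q * a * b + (1 + q) ^ 2 * c) * X
      + C (q * b ^ 2 + (1 + q) ^ 2 * d) with hp
    have hp0 : p ≠ 0 := by
      intro h0
      have h1 := congrArg natDegree h0
      rw [hp, natDegree_quadratic (mul_ne_zero hq0 (pow_ne_zero _ haC))] at h1
      simp at h1
    refine hp0 (eq_zero_of_infinite_isRoot p (infinite_of_mem_nhds z₀ ?_))
    filter_upwards [hcon, hU] with z hz hzU
    have h1 : l z = q * m z := (div_eq_iff hzU.2.2.1).1 hz
    have h2 := hadd z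
    have h3 := hmul z hzU.2.1
    rw [h1] at h2 h3
    simp only [IsRoot.def, hp, eval_add, eval_mul, eval_C, eval_pow, eval_X]
    linear_combination (-q * (q * m z + m z + a * z + b)) * h2 + (1 + q) ^ 2 * h3
  filter_upwards [eventually_exists_pow_eq (hla.div hma hm0) (hzla.div hzma hzm) hnorm hne
    (div_ne_zero hzl hzm) hU] with n hn
  obtain ⟨z, ⟨hzim, hzΔ, hzm0, hzmne⟩, hz⟩ := hn
  intro hreal
  refine hzim (hreal z ?_)
  have h1 := sub_mul_aeval_W a b c d (hadd z) (hmul z hzΔ) n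
  have h2 : (z - m z) * l z ^ n - (z - l z) * m z ^ n = 0 := by
    have h3 : (l z / m z) ^ n = (z - l z) / (z - m z) := hz
    rw [div_pow, div_eq_div_iff (pow_ne_zero _ hzm0) hzmne] at h3
    linear_combination h3
  have h4 : l z - m z = S z := by simp only [hl, hm]; ring
  rw [h2, h4] at h1
  exact (mul_eq_zero.1 h1).resolve_left (hS0 z)

end LinRec

theorem mainTheorem4 (a b c d : ℝ) (hac : a * c ≠ 0)
    (hN : ¬ LinRec.FirstOrderRec (LinRec.W a b c d))
    (hreal : ∀ᶠ n : ℕ in atTop, LinRec.RealRooted (LinRec.W a b c d n)) :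
    (LinRec.B c d).eval (LinRec.xA a b) ≤ 0 ∧ 0 ≤ LinRec.DeltaDelta a b c d := by
  have hB : (LinRec.B c d).eval (LinRec.xA a b) ≤ 0 := by
    by_contra! hβ
    obtain ⟨n, hn, hn'⟩ :=
      (hreal.and (LinRec.eventually_not_realRooted (left_ne_zero_of_mul hac) hN hβ)).exists
    exact hn' hn
  refine ⟨hB, ?_⟩
  rw [LinRec.DeltaDelta]
  nlinarith [mul_nonneg (sq_nonneg a) (neg_nonneg.2 hB), sq_nonneg c]
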